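/- Setting. Let $\mathcal F$ be a convex compact subset of an $L^2$ space of $\mathbb R^k$-valued functions, let $\Theta\subseteq\mathbb R^p$ and let $f_\theta\in\mathcal F$ for $\theta\in\Theta$; put $\mathcal F_\theta=\{f_\theta:\theta\in\Theta\}$. Let $\ell_0,\ell_1,\dots,\ell_m:\mathcal F\to\mathbb R$ be functionals, $\ell=(\ell_1,\dots,\ell_m)$, and $L(\phi,\lambda)=\ell_0(\phi)+\lambda^T\ell(\phi)$ for $\lambda\in\mathbb R^m$. Put $g_u(\lambda)=\inf_{\phi\in\mathcal F}L(\phi,\lambda)$, $g_p(\lambda)=\inf_{\theta\in\Theta}L(f_\theta,\lambda)$ and $D^\star_p=\sup_{\lambda\succeq0}g_p(\lambda)$. Let $\phi^\star$ minimize $\ell_0$ over $\{\phi\in\mathcal F:\ell(\phi)\preceq0\}$ and let $\lambda^\star_u\succeq 0$ maximize $g_u$ over $\lambda\succeq0$. Assumptions. (1) Each $\ell_i$, $i=0,\dots,m$, is convex and $M$-Lipschitz on $\mathcal F$, and $\ell_0$ is $\mu_0$-strongly convex, $\mu_0>0$. (3) For every $\phi\in\mathcal F$ there is $\theta\in\Theta$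 with $\|\phi-f_\theta\|_{L_2}\le\nu$. (5) Each $\ell_i$, $i=0,\dots,m$, is $\beta$-smooth on $\mathcal F$, i.e. Fréchet differentiable on $\mathcal F$ with $\beta$-Lipschitz derivative. (6) There is $\sigma>0$ with $\|\lambda^T D_\phi\ell(\phi^\star)\|\ge\sigma$ for all $\lambda\in\mathbb R^m$ with $\|\lambda\|_2=1$. Derivatives and their dual norms are taken along the closed linear span of $\mathcal F-\mathcal F$. Proposition 4.1. Let $\eta>0$, $\rho\ge0$, $S\in\mathbb R$, and let $\lambda^{\mathrm{best}}\succeq0$ (for instance an iterate of projected stochastic dual ascent with step size $\eta$, a $\rho$-approximate Lagrangian minimization oracle, and stochastic supergradients with conditional second moment below $S^2$) satisfy $$g_p(\lambda^{\mathrm{best}})\ \ge\ D^\star_p-\Big(\frac{\eta S^2}{2}+\rho\Big).$$ Let $f_\theta(\lambda^{\mathrm{best}})$ be any minimizer of $L(\cdot,\lambda^{\mathrm{best}})$ over $\mathcal F_\theta$ and let $\phi(\lambda^{\mathrm{best}})$ be the minimizer of $L(\cdot,\lambda^{\mathrm{best}})$ over $\mathcal F$. Suppose that there is $\phi\in\mathcal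 F$ with $\ell(\phi)\prec\min\{\mathbf 0,\ \ell(\phi(\lambda^{\mathrm{best}})),\ \ell(f_\theta(\lambda^{\mathrm{best}}))\}$ componentwise. Then $$\|\ell(\phi^\star)-\ell(f_\theta(\lambda^{\mathrm{best}}))\|_2^2\ \le\ 2\beta_g\Big(M\nu\,(1+\|\lambda^{\mathrm{best}}\|_1)+\frac{\eta S^2}{2}+\rho\Big)\Big(1+\sqrt{\beta_g/\tilde\mu_g}\Big)^2,$$ $$\tilde\mu_g=\frac{\mu_0\,\sigma^2}{\beta^2\,\big(1+\max\{\|\lambda^\star_u\|_1,\|\lambda^{\mathrm{best}}\|_1\}\big)^2},$$ where $\beta_g=mM^2/\mu_0$; and the same bound holds with $\beta_g=\sqrt m\,M^2/\mu_0$ (in the bound and in the ratio) if in addition the vector-valued map $\ell:\mathcal F\to(\mathbb R^m,\|\cdot\|_2)$ is $M$-Lipschitz. -/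

import Mathlib

open MeasureTheory
open scoped NNReal

noncomputable section

/-- The space `L²(𝒳, P; ℝᵏ)` of square-integrable hypotheses. -/
abbrev HypSpace {X : Type*} [MeasurableSpace X] (P : Measure X) (k : ℕ) : Type _ :=
  Lp (EuclideanSpace ℝ (Fin k)) 2 P

section General

variable {H : Type*} [NormedAddCommGroup H] [NormedSpace ℝ H] {m : ℕ}

/-- The vector `ℓ(φ) = (ℓ₁(φ), …, ℓₘ(φ))`, with the Euclidean norm. -/
def constraintVec (l : Fin m → H → ℝ) (φ : H) : EuclideanSpace ℝ (Fin m) :=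
  WithLp.toLp 2 (fun i => l i φ)

/-- `‖lam‖₁`. -/
def oneNorm (lam : EuclideanSpace ℝ (Fin m)) : ℝ := ∑ i, |lam i|

/-- The Lagrangian `L(φ, lam) = ℓ₀(φ) + lamᵀ ℓ(φ)`. -/
def lagrangian (l₀ : H → ℝ) (l : Fin m → H → ℝ) (φ : H) (lam : EuclideanSpace ℝ (Fin m)) : ℝ :=
  l₀ φ + ∑ i, lam i * l i φ

/-- The set of Lagrangian minimizers over the class `A` at the multiplier `lam`. -/
def lagrangianMinimizers (A : Set H) (l₀ : H → ℝ) (l : Fin m → H → ℝ)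
    (lam : EuclideanSpace ℝ (Fin m)) : Set H :=
  {φ | φ ∈ A ∧ ∀ ψ ∈ A, lagrangian l₀ l φ lam ≤ lagrangian l₀ l ψ lam}

/-- The dual function `g(lam) = inf_{φ ∈ A} L(φ, lam)` of the problem over the class `A`,
with values in the extended reals. -/
def dualFunction (A : Set H) (l₀ : H → ℝ) (l : Fin m → H → ℝ)
    (lam : EuclideanSpace ℝ (Fin m)) : EReal :=
  ⨅ φ ∈ A, ((lagrangian l₀ l φ lam : ℝ) : EReal)

/-- The optimal dual value `D⋆ = sup_{lam ⪰ 0} g(lam)` of the problem over the class `A`. -/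
def dualValue (A : Set H) (l₀ : H → ℝ) (l : Fin m → H → ℝ) : EReal :=
  ⨆ lam ∈ {lam : EuclideanSpace ℝ (Fin m) | ∀ i, 0 ≤ lam i}, dualFunction A l₀ l lam

/-- `lam` is an optimal multiplier: `lam ⪰ 0` and `lam` attains the optimal dual value. -/
def IsDualSolution (A : Set H) (l₀ : H → ℝ) (l : Fin m → H → ℝ)
    (lam : EuclideanSpace ℝ (Fin m)) : Prop :=
  (∀ i, 0 ≤ lam i) ∧ dualFunction A l₀ l lam = dualValue A l₀ l

/-- `φ` solves `min ℓ₀` over `A` subject to `ℓᵢ ≤ 0` for all `i`. -/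
def IsPrimalSolution (A : Set H) (l₀ : H → ℝ) (l : Fin m → H → ℝ) (φ : H) : Prop :=
  φ ∈ A ∧ (∀ i, l i φ ≤ 0) ∧ ∀ ψ ∈ A, (∀ i, l i ψ ≤ 0) → l₀ φ ≤ l₀ ψ

/-- The closed linear space spanned by the differences of elements of `F`. Derivatives of
functionals that are only defined on `F` are determined on this space, and only there. -/
def directionSpace (F : Set H) : Submodule ℝ H := (vectorSpan ℝ F).topologicalClosure

/-- The dual norm of a functional with respect to `F`: its operator norm on the space of
directions of `F`. -/
def dualNormOn (F : Set H) (B : H →L[ℝ] ℝ) : ℝ := ‖B.comp (directionSpace F).subtypeL‖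

/-- `h` is `β`-smooth on `F`: Fréchet differentiable on `F`, with `β`-Lipschitz derivative. -/
def IsSmoothOn (F : Set H) (β : ℝ≥0) (h : H → ℝ) : Prop :=
  ∃ D : H → (H →L[ℝ] ℝ), (∀ φ ∈ F, HasFDerivWithinAt h (D φ) F φ) ∧
    ∀ φ ∈ F, ∀ ψ ∈ F, dualNormOn F (D φ - D ψ) ≤ β * ‖φ - ψ‖

/-- The Jacobian `Dℓ(φ)` has full row rank with constant `σ`: `‖lamᵀ Dℓ(φ)‖ ≥ σ` for every
`lam` of Euclidean norm one. -/
def HasFullRowRankAt (F : Set H) (σ : ℝ) (l : Fin m → H → ℝ) (φ : H) : Prop :=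
  ∃ B : Fin m → (H →L[ℝ] ℝ), (∀ i, HasFDerivWithinAt (l i) (B i) F φ) ∧
    ∀ lam : EuclideanSpace ℝ (Fin m), ‖lam‖ = 1 → σ ≤ dualNormOn F (∑ i, lam i • B i)

end General

end

/-! Fix the multiplier `lamBest`. The Lagrangian is `μ₀`-strongly convex on `F`, with a minimizer
`φb`. Both `φstar` and `fBest` minimize it up to the same error `Δ = M ν (1 + ‖lamBest‖₁) + η S² / 2
+ ρ`. For `fBest` this is near-universality and the Lipschitz bounds. For `φstar`, feasibility gives
`L(φstar) ≤ l₀ φstar`, and strong duality over `F` with near-optimality of `lamBest` gives `l₀ φstar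
≤ L(fBest) + η S² / 2 + ρ`.

Quadratic growth (`StrongConvexOn.norm_sub_sq_le`) and the Lipschitz bound on the constraints place
both constraint vectors within `√(2 βg Δ)` of that of `φb`, hence within `2 √(2 βg Δ)` of each
other. Strong concavity of the dual function is not needed: `μg` enters only through `βg / μg ≥ 1`,
which turns the factor 2 into `1 + √(βg / μg)`. -/

open Filter Topology

/-! ### Derivatives and strong convexity on a convex set -/

section Calculus

variable {H : Type*} [NormedAddCommGroup H] [NormedSpace ℝ H]

/-- The one-sided directional derivative of `h` at a point of a convex set, towards another
point of the set. -/
theorem tendsto_slope_of_hasFDerivWithinAt {F : Set H} (hF : Convex ℝ F) {h : H → ℝ}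
    {B : H →L[ℝ] ℝ} {φ ψ : H} (hφ : φ ∈ F) (hψ : ψ ∈ F) (hB : HasFDerivWithinAt h B F φ) :
    Tendsto (fun t : ℝ => t⁻¹ * (h (φ + t • (ψ - φ)) - h φ)) (𝓝[>] 0) (𝓝 (B (ψ - φ))) := by
  have hline : HasDerivWithinAt (fun t : ℝ => φ + t • (ψ - φ)) (ψ - φ) (Set.Ioc 0 1) 0 := by
    simpa using (((hasDerivAt_id (0 : ℝ)).smul_const (ψ - φ)).const_add φ).hasDerivWithinAt
  have hmaps : Set.MapsTo (fun t : ℝ => φ + t • (ψ - φ)) (Set.Ioc 0 1) F :=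
    fun t ht => hF.add_smul_sub_mem hφ hψ ⟨ht.1.le, ht.2⟩
  have hB' : HasFDerivWithinAt h B F (φ + (0 : ℝ) • (ψ - φ)) := by simpa using hB
  have hcomp := hB'.comp_hasDerivWithinAt (0 : ℝ) hline hmaps
  -- `Ioc 0 1` omits the base point 0 and has the right neighbourhoods of 0 as its germ there.
  rw [hasDerivWithinAt_iff_tendsto_slope' (by simp), nhdsWithin_Ioc_eq_nhdsGT zero_lt_one] at hcomp
  refine hcomp.congr fun t => ?_
  simp [slope_def_field, div_eq_inv_mul]

/-- A derivative of a `K`-Lipschitz functional on a convex set is bounded by `K` on differences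
of points of the set, also at boundary points. -/
theorem abs_fderivWithin_sub_le {F : Set H} (hF : Convex ℝ F) {h : H → ℝ} {K : ℝ≥0}
    (hK : LipschitzOnWith K h F) {B : H →L[ℝ] ℝ} {φ a b : H} (hφ : φ ∈ F) (ha : a ∈ F)
    (hb : b ∈ F) (hB : HasFDerivWithinAt h B F φ) : |B (a - b)| ≤ K * ‖a - b‖ := by
  -- `a - b` need not point into `F` at `φ`, so the slopes towards `a` and towards `b` are
  -- subtracted; the moving points lie `t ‖a - b‖` apart.
  have hlim := ((tendsto_slope_of_hasFDerivWithinAt hF hφ ha hB).sub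
    (tendsto_slope_of_hasFDerivWithinAt hF hφ hb hB)).abs
  rw [← map_sub, sub_sub_sub_cancel_right] at hlim
  refine le_of_tendsto hlim ?_
  filter_upwards [Ioc_mem_nhdsGT (zero_lt_one' ℝ)] with t ht
  have hdist := hK.dist_le_mul _ (hF.add_smul_sub_mem hφ ha ⟨ht.1.le, ht.2⟩) _
    (hF.add_smul_sub_mem hφ hb ⟨ht.1.le, ht.2⟩)
  rw [Real.dist_eq, dist_eq_norm, add_sub_add_left_eq_sub, ← smul_sub,
    sub_sub_sub_cancel_right, norm_smul, Real.norm_of_nonneg ht.1.le] at hdist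
  rw [← mul_sub, sub_sub_sub_cancel_right, abs_mul, abs_inv, abs_of_pos ht.1,
    inv_mul_le_iff₀ ht.1]
  linarith

/-- The linear span of the differences of a nonempty convex set consists of the nonnegative
multiples of such differences. -/
theorem exists_eq_smul_sub_of_mem_vectorSpan {F : Set H} (hF : Convex ℝ F) (hne : F.Nonempty)
    {v : H} (hv : v ∈ vectorSpan ℝ F) : ∃ c : ℝ, 0 ≤ c ∧ ∃ a ∈ F, ∃ b ∈ F, v = c • (a - b) := by
  obtain ⟨z, hz⟩ := hne
  rw [vectorSpan_def] at hv
  induction hv using Submodule.span_induction with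
  | mem x hx =>
    obtain ⟨a, ha, b, hb, rfl⟩ := Set.mem_vsub.1 hx
    exact ⟨1, zero_le_one, a, ha, b, hb, by simp⟩
  | zero => exact ⟨0, le_rfl, z, hz, z, hz, by simp⟩
  | add x y _ _ hx hy =>
    obtain ⟨c, hc, a, ha, b, hb, rfl⟩ := hx
    obtain ⟨d, hd, a', ha', b', hb', rfl⟩ := hy
    rcases (add_nonneg hc hd).eq_or_lt with hs | hs
    · have hc0 : c = 0 := by linarith
      have hd0 : d = 0 := by linarith
      exact ⟨0, le_rfl, z, hz, z, hz, by simp [hc0, hd0]⟩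
    -- `c (a - b) + d (a' - b')` is `c + d` times the difference of two convex combinations with
    -- weights `c / (c + d)` and `d / (c + d)`.
    · have hsum : c / (c + d) + d / (c + d) = 1 := by rw [← add_div, div_self hs.ne']
      refine ⟨c + d, hs.le, _, hF ha ha' (div_nonneg hc hs.le) (div_nonneg hd hs.le) hsum,
        _, hF hb hb' (div_nonneg hc hs.le) (div_nonneg hd hs.le) hsum, ?_⟩
      have h1 : (c + d) * (c / (c + d)) = c := mul_div_cancel₀ _ hs.ne'
      have h2 : (c + d) * (d / (c + d)) = d := mul_div_cancel₀ _ hs.ne'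
      simp only [smul_sub, smul_add, smul_smul, h1, h2]
      abel
  | smul r x _ hx =>
    obtain ⟨c, hc, a, ha, b, hb, rfl⟩ := hx
    rcases le_total 0 r with hr | hr
    · exact ⟨r * c, mul_nonneg hr hc, a, ha, b, hb, smul_smul _ _ _⟩
    · refine ⟨-r * c, mul_nonneg (neg_nonneg.2 hr) hc, b, hb, a, ha, ?_⟩
      rw [smul_smul, neg_mul, neg_smul, ← smul_neg, neg_sub]

/-- The dual norm of a derivative of a `K`-Lipschitz functional is at most `K`. -/
theorem dualNormOn_le_of_lipschitzOnWith {F : Set H} (hF : Convex ℝ F) {h : H → ℝ} {K : ℝ≥0}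
    (hK : LipschitzOnWith K h F) {B : H →L[ℝ] ℝ} {φ : H} (hφ : φ ∈ F)
    (hB : HasFDerivWithinAt h B F φ) : dualNormOn F B ≤ K := by
  refine ContinuousLinearMap.opNorm_le_bound _ K.2 fun v => ?_
  have hclosed : IsClosed {v : H | ‖B v‖ ≤ K * ‖v‖} :=
    isClosed_le (by fun_prop) (by fun_prop)
  have hsub : (vectorSpan ℝ F : Set H) ⊆ {v : H | ‖B v‖ ≤ K * ‖v‖} := by
    intro v hv
    obtain ⟨c, hc, a, ha, b, hb, rfl⟩ := exists_eq_smul_sub_of_mem_vectorSpan hF ⟨φ, hφ⟩ hv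
    have := abs_fderivWithin_sub_le hF hK hφ ha hb hB
    rw [Set.mem_ofPred_eq, map_smul, norm_smul, norm_smul, Real.norm_of_nonneg hc,
      Real.norm_eq_abs]
    calc c * |B (a - b)| ≤ c * (K * ‖a - b‖) := by gcongr
      _ = K * (c * ‖a - b‖) := by ring
  exact closure_minimal hsub hclosed v.2

/-- Points of `F` differ by elements of the direction space, on which the dual norm acts. -/
theorem abs_apply_sub_le_dualNormOn {F : Set H} (B : H →L[ℝ] ℝ) {a b : H} (ha : a ∈ F)
    (hb : b ∈ F) : |B (a - b)| ≤ dualNormOn F B * ‖a - b‖ :=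
  (B.comp (directionSpace F).subtypeL).le_opNorm
    ⟨a - b, Submodule.le_topologicalClosure _ (vsub_mem_vectorSpan ℝ ha hb)⟩

/-- The first-order lower bound for strongly convex functions. -/
theorem StrongConvexOn.add_fderivWithin_le {F : Set H} {h : H → ℝ} {μ : ℝ}
    (hh : StrongConvexOn F μ h) {B : H →L[ℝ] ℝ} {φ ψ : H} (hφ : φ ∈ F) (hψ : ψ ∈ F)
    (hB : HasFDerivWithinAt h B F φ) : h φ + B (ψ - φ) + μ / 2 * ‖ψ - φ‖ ^ 2 ≤ h ψ := by
  have hlim := tendsto_slope_of_hasFDerivWithinAt hh.1 hφ hψ hB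
  have hright : Tendsto (fun t : ℝ => h ψ - h φ - (1 - t) * (μ / 2 * ‖ψ - φ‖ ^ 2)) (𝓝[>] 0)
      (𝓝 (h ψ - h φ - (1 - 0) * (μ / 2 * ‖ψ - φ‖ ^ 2))) :=
    Tendsto.mono_left (Continuous.tendsto (by fun_prop) 0) nhdsWithin_le_nhds
  have := le_of_tendsto_of_tendsto hlim hright ?_
  · linarith
  filter_upwards [Ioc_mem_nhdsGT (zero_lt_one' ℝ)] with t ht
  have hconv := hh.2 hψ hφ ht.1.le (sub_nonneg.2 ht.2) (add_sub_cancel t 1)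
  have hpt : t • ψ + (1 - t) • φ = φ + t • (ψ - φ) := by
    rw [sub_smul, one_smul, smul_sub]; abel
  rw [hpt] at hconv
  simp only [smul_eq_mul] at hconv
  rw [inv_mul_le_iff₀ ht.1]
  linarith

/-- The strong convexity constant is at most the smoothness constant. -/
theorem StrongConvexOn.le_of_isSmoothOn {F : Set H} {h : H → ℝ} {μ : ℝ} {β : ℝ≥0}
    (hh : StrongConvexOn F μ h) (hβ : IsSmoothOn F β h) (hF : F.Nontrivial) : μ ≤ β := by
  obtain ⟨a, ha, b, hb, hab⟩ := hF
  obtain ⟨D, hD, hLip⟩ := hβ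
  have hpos : 0 < ‖a - b‖ := norm_pos_iff.2 (sub_ne_zero.2 hab)
  -- Adding the two first-order bounds gives `μ ‖a - b‖² ≤ (D a - D b) (a - b) ≤ β ‖a - b‖²`.
  have h1 := hh.add_fderivWithin_le ha hb (hD a ha)
  have h2 := hh.add_fderivWithin_le hb ha (hD b hb)
  have h3 := (le_abs_self _).trans (abs_apply_sub_le_dualNormOn (D a - D b) ha hb)
  have h4 := mul_le_mul_of_nonneg_right (hLip a ha b hb) hpos.le
  have h5 : D a (b - a) = -D a (a - b) := by rw [← map_neg, neg_sub]
  rw [norm_sub_rev b a, h5] at h1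
  rw [sub_apply] at h3
  refine le_of_mul_le_mul_right ?_ (pow_pos hpos 2)
  nlinarith

/-- A strongly convex function grows quadratically away from its minimizer. -/
theorem StrongConvexOn.norm_sub_sq_le {F : Set H} {h : H → ℝ} {μ : ℝ}
    (hh : StrongConvexOn F μ h) {φ ψ : H} (hφ : φ ∈ F) (hmin : ∀ x ∈ F, h φ ≤ h x) (hψ : ψ ∈ F) :
    μ / 2 * ‖ψ - φ‖ ^ 2 ≤ h ψ - h φ := by
  have hlim : Tendsto (fun t : ℝ => (1 - t) * (μ / 2 * ‖ψ - φ‖ ^ 2)) (𝓝[>] 0)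
      (𝓝 ((1 - 0) * (μ / 2 * ‖ψ - φ‖ ^ 2))) :=
    Tendsto.mono_left (Continuous.tendsto (by fun_prop) 0) nhdsWithin_le_nhds
  rw [sub_zero, one_mul] at hlim
  refine le_of_tendsto hlim ?_
  filter_upwards [Ioc_mem_nhdsGT (zero_lt_one' ℝ)] with t ht
  -- Strong convexity on the segment, with minimality of `h φ`, gives the claim multiplied by `t`,
  -- up to the factor `1 - t`, which tends to 1.
  have ht' := sub_nonneg.2 ht.2
  have hconv := hh.2 hψ hφ ht.1.le ht' (add_sub_cancel t 1)
  have hle := hmin _ (hh.1 hψ hφ ht.1.le ht' (add_sub_cancel t 1))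
  simp only [smul_eq_mul] at hconv
  refine le_of_mul_le_mul_left ?_ ht.1
  linarith

end Calculus

/-! ### Lagrangian duality and the Lagrangian at a fixed multiplier -/

section Duality

variable {H : Type*} [NormedAddCommGroup H] [NormedSpace ℝ H] {m : ℕ}

/-- Strong duality: under Slater's condition a convex program has a multiplier for which the
Lagrangian is bounded below by the optimal value. -/
theorem exists_multiplier_le_lagrangian {F : Set H} {l₀ : H → ℝ} {l : Fin m → H → ℝ}
    (h₀ : ConvexOn ℝ F l₀) (hl : ∀ i, ConvexOn ℝ F (l i)) {c : ℝ}
    (hc : ∀ ψ ∈ F, (∀ i, l i ψ ≤ 0) → c ≤ l₀ ψ) (hslater : ∃ φ ∈ F, ∀ i, l i φ < 0) :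
    ∃ lam : EuclideanSpace ℝ (Fin m), (∀ i, 0 ≤ lam i) ∧ ∀ φ ∈ F, c ≤ lagrangian l₀ l φ lam := by
  classical
  -- Pairs strictly above some achievable pair of constraint values and objective gap. Strictness
  -- makes `A` open, and 0 lies outside since `c` bounds the feasible values below; a separating
  -- functional yields the multiplier.
  set A : Set ((Fin m → ℝ) × ℝ) :=
    {u | ∃ φ ∈ F, (∀ i, l i φ < u.1 i) ∧ l₀ φ - c < u.2} with hA
  have hAconv : Convex ℝ A := by
    rintro u ⟨φ, hφ, hu, hu'⟩ v ⟨ψ, hψ, hv, hv'⟩ a b ha hb hab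
    have key : ∀ {x y x' y' : ℝ}, x < x' → y < y' → a * x + b * y < a * x' + b * y' := by
      intro x y x' y' hx hy
      rcases ha.eq_or_lt with rfl | ha'
      · have : b = 1 := by linarith
        simpa [this] using hy
      · have := mul_lt_mul_of_pos_left hx ha'
        have := mul_le_mul_of_nonneg_left hy.le hb
        linarith
    refine ⟨a • φ + b • ψ, h₀.1 hφ hψ ha hb hab, fun i => ?_, ?_⟩
    · exact ((hl i).2 hφ hψ ha hb hab).trans_lt (key (hu i) (hv i))
    · have h1 := h₀.2 hφ hψ ha hb hab
      have h2 := key hu' hv'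
      simp only [smul_eq_mul, Prod.snd_add, Prod.smul_snd] at h1 h2 ⊢
      have : a * c + b * c = c := by rw [← add_mul, hab, one_mul]
      linarith
  have hAopen : IsOpen A := by
    have : A = ⋃ φ ∈ F, {u : (Fin m → ℝ) × ℝ | (∀ i, l i φ < u.1 i) ∧ l₀ φ - c < u.2} := by
      ext u; simp only [hA, Set.mem_ofPred_eq, Set.mem_iUnion, exists_prop]
    rw [this]
    refine isOpen_biUnion fun φ _ => IsOpen.and ?_ (isOpen_lt continuous_const continuous_snd)
    simp only [Set.ofPred_forall]
    exact isOpen_iInter_of_finite fun i => isOpen_lt continuous_const (by fun_prop)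
  have h0 : (0 : (Fin m → ℝ) × ℝ) ∉ A := by
    rintro ⟨φ, hφ, hu, hu'⟩
    have := hc φ hφ fun i => (hu i).le
    simp only [Prod.snd_zero] at hu'
    linarith
  obtain ⟨g, hg⟩ := geometric_hahn_banach_open_point hAconv hAopen h0
  rw [map_zero] at hg
  set q : Fin m → ℝ := fun i => g (Pi.single i 1, 0) with hq
  set r : ℝ := g (0, 1) with hr
  have hexp : ∀ u : (Fin m → ℝ) × ℝ, g u = ∑ i, u.1 i * q i + u.2 * r := by
    intro u
    have h1 : u = ∑ i, u.1 i • ((Pi.single i 1, 0) : (Fin m → ℝ) × ℝ) + u.2 • (0, 1) := by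
      ext j
      · simp [Prod.fst_sum, Finset.sum_apply, Pi.single_apply]
      · simp [Prod.snd_sum]
    conv_lhs => rw [h1]
    simp only [map_add, map_sum, map_smul, smul_eq_mul, hq, hr]
  have hlim : ∀ φ ∈ F, ∑ i, l i φ * q i + (l₀ φ - c) * r ≤ 0 := by
    intro φ hφ
    have hmem : ∀ t : ℝ, 0 < t → ∑ i, (l i φ + t) * q i + (l₀ φ - c + t) * r < 0 := by
      intro t ht
      have := hg (fun i => l i φ + t, l₀ φ - c + t) ⟨φ, hφ, fun i => by simpa, by simpa⟩
      rwa [hexp] at this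
    have hcont : Tendsto (fun t : ℝ => ∑ i, (l i φ + t) * q i + (l₀ φ - c + t) * r) (𝓝[>] 0)
        (𝓝 (∑ i, (l i φ + 0) * q i + (l₀ φ - c + 0) * r)) :=
      Tendsto.mono_left (Continuous.tendsto (by fun_prop) 0) nhdsWithin_le_nhds
    simp only [add_zero] at hcont
    exact le_of_tendsto hcont (eventually_nhdsWithin_of_forall fun t ht => (hmem t ht).le)
  obtain ⟨φ₁, hφ₁, hneg⟩ := hslater
  -- Nonnegative directions are recession directions of `A`, on which `g < 0`. If `g w > 0`, the
  -- step `|g u| / g w` would reach a point of `A` with `g ≥ 0`.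
  have hdir : ∀ (w : (Fin m → ℝ) × ℝ), (∀ i, 0 ≤ w.1 i) → 0 ≤ w.2 → g w ≤ 0 := by
    intro w hw hw'
    by_contra! hpos
    set u : (Fin m → ℝ) × ℝ := (fun i => l i φ₁ + 1, l₀ φ₁ - c + 1) with hu
    set t : ℝ := |g u| / g w with ht
    have ht0 : 0 ≤ t := div_nonneg (abs_nonneg _) hpos.le
    have hlt := hg (u + t • w) ⟨φ₁, hφ₁, fun i => ?_, ?_⟩
    · rw [map_add, map_smul, smul_eq_mul, ht, div_mul_cancel₀ _ hpos.ne'] at hlt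
      linarith [neg_abs_le (g u)]
    · have := mul_nonneg ht0 (hw i)
      simp only [hu, Prod.fst_add, Prod.smul_fst, Pi.add_apply, Pi.smul_apply, smul_eq_mul]
      linarith
    · have := mul_nonneg ht0 hw'
      simp only [hu, Prod.snd_add, Prod.smul_snd, smul_eq_mul]
      linarith
  have hq0 : ∀ i, q i ≤ 0 := fun i => hdir _
    (fun j => by by_cases h : j = i <;> simp [h]) le_rfl
  -- The Slater point puts `(0, l₀ φ₁ - c + 1)` in `A`; with `r = 0` the functional would vanish
  -- there. So the separating hyperplane is not vertical and can be normalized by `r`.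
  have hr0 : r < 0 := by
    refine lt_of_le_of_ne (hdir _ (fun _ => le_rfl) zero_le_one) fun hr' => ?_
    have h1 := hg (0, l₀ φ₁ - c + 1) ⟨φ₁, hφ₁, hneg, by simp⟩
    rw [hexp, hr'] at h1
    simp at h1
  refine ⟨WithLp.toLp 2 fun i => q i / r, fun i => div_nonneg_of_nonpos (hq0 i) hr0.le,
    fun φ hφ => ?_⟩
  have h1 := hlim φ hφ
  have h2 : lagrangian l₀ l φ (WithLp.toLp 2 fun i => q i / r) - c =
      (∑ i, l i φ * q i + (l₀ φ - c) * r) / r := by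
    have : ∑ i, q i / r * l i φ = (∑ i, l i φ * q i) / r := by
      rw [Finset.sum_div]
      exact Finset.sum_congr rfl fun i _ => by ring
    simp only [lagrangian, this]
    field_simp [hr0.ne]
    ring
  have h3 := div_nonneg_of_nonpos h1 hr0.le
  linarith

/-- The Lagrangian at a nonnegative multiplier inherits strong convexity from the objective. -/
theorem strongConvexOn_lagrangian {F : Set H} {l₀ : H → ℝ} {l : Fin m → H → ℝ} {μ : ℝ}
    (h₀ : StrongConvexOn F μ l₀) (hl : ∀ i, ConvexOn ℝ F (l i)) {lam : EuclideanSpace ℝ (Fin m)}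
    (hlam : ∀ i, 0 ≤ lam i) : StrongConvexOn F μ fun φ => lagrangian l₀ l φ lam := by
  refine ⟨h₀.1, fun x hx y hy a b ha hb hab => ?_⟩
  have h1 := h₀.2 hx hy ha hb hab
  have h2 : ∑ i, lam i * l i (a • x + b • y) ≤
      a * ∑ i, lam i * l i x + b * ∑ i, lam i * l i y := by
    rw [Finset.mul_sum, Finset.mul_sum, ← Finset.sum_add_distrib]
    refine Finset.sum_le_sum fun i _ => ?_
    have := mul_le_mul_of_nonneg_left ((hl i).2 hx hy ha hb hab) (hlam i)
    simp only [smul_eq_mul] at this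
    linarith
  simp only [smul_eq_mul, lagrangian] at h1 ⊢
  linarith

theorem oneNorm_nonneg (lam : EuclideanSpace ℝ (Fin m)) : 0 ≤ oneNorm lam :=
  Finset.sum_nonneg fun _ _ => abs_nonneg _

-- The Lipschitz constants add up with weights 1 and `|lam i|`; this is the source of `M ν (1 +
-- ‖lam‖₁)`.
omit [NormedSpace ℝ H] in
theorem lagrangian_sub_le {F : Set H} {l₀ : H → ℝ} {l : Fin m → H → ℝ} {K : ℝ≥0}
    (h₀ : LipschitzOnWith K l₀ F) (hl : ∀ i, LipschitzOnWith K (l i) F)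
    (lam : EuclideanSpace ℝ (Fin m)) {φ ψ : H} (hφ : φ ∈ F) (hψ : ψ ∈ F) :
    lagrangian l₀ l φ lam - lagrangian l₀ l ψ lam ≤ K * (1 + oneNorm lam) * ‖φ - ψ‖ := by
  have h1 := (le_abs_self _).trans (h₀.dist_le_mul φ hφ ψ hψ)
  have h2 : ∑ i, lam i * l i φ - ∑ i, lam i * l i ψ ≤ oneNorm lam * (K * ‖φ - ψ‖) := by
    rw [← Finset.sum_sub_distrib, oneNorm, Finset.sum_mul]
    refine Finset.sum_le_sum fun i _ => ?_
    have := (hl i).dist_le_mul φ hφ ψ hψ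
    rw [Real.dist_eq, dist_eq_norm] at this
    calc lam i * l i φ - lam i * l i ψ ≤ |lam i * (l i φ - l i ψ)| := by
          rw [mul_sub]; exact le_abs_self _
      _ = |lam i| * |l i φ - l i ψ| := abs_mul _ _
      _ ≤ _ := by gcongr
  rw [dist_eq_norm] at h1
  simp only [lagrangian]
  linarith

omit [NormedSpace ℝ H] in
theorem continuousOn_lagrangian {F : Set H} {l₀ : H → ℝ} {l : Fin m → H → ℝ} {K : ℝ≥0}
    (h₀ : LipschitzOnWith K l₀ F) (hl : ∀ i, LipschitzOnWith K (l i) F)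
    (lam : EuclideanSpace ℝ (Fin m)) : ContinuousOn (fun φ => lagrangian l₀ l φ lam) F :=
  h₀.continuousOn.add <| continuousOn_finsetSum _ fun i _ =>
    continuousOn_const.mul (hl i).continuousOn

omit [NormedAddCommGroup H] [NormedSpace ℝ H] in
theorem lagrangian_le_of_nonpos {l₀ : H → ℝ} {l : Fin m → H → ℝ}
    {lam : EuclideanSpace ℝ (Fin m)} (hlam : ∀ i, 0 ≤ lam i) {φ : H} (hφ : ∀ i, l i φ ≤ 0) :
    lagrangian l₀ l φ lam ≤ l₀ φ := by
  have : ∑ i, lam i * l i φ ≤ 0 :=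
    Finset.sum_nonpos fun i _ => mul_nonpos_of_nonneg_of_nonpos (hlam i) (hφ i)
  simp only [lagrangian]
  linarith

/-- A near-optimal multiplier for a subclass `A ⊆ F` has Lagrangian values on `A` which are nearly
at least the optimal value of the program over `F`. -/
theorem sub_le_lagrangian_of_dualValue_sub_le {F A : Set H} {l₀ : H → ℝ} {l : Fin m → H → ℝ}
    (h₀ : ConvexOn ℝ F l₀) (hl : ∀ i, ConvexOn ℝ F (l i)) (hA : A ⊆ F)
    (hslater : ∃ φ ∈ F, ∀ i, l i φ < 0) {φs : H} (hφs : IsPrimalSolution F l₀ l φs) {ε : ℝ}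
    {lam : EuclideanSpace ℝ (Fin m)}
    (hlam : dualValue A l₀ l - (ε : EReal) ≤ dualFunction A l₀ l lam) {φ : H} (hφ : φ ∈ A) :
    l₀ φs - ε ≤ lagrangian l₀ l φ lam := by
  obtain ⟨lam', hlam', hle⟩ := exists_multiplier_le_lagrangian h₀ hl hφs.2.2 hslater
  -- The multiplier found over `F` still bounds the Lagrangian over the smaller set `A`, which need
  -- not be convex; so the dual value over `A` is at least the primal value over `F`.
  have h1 : ((l₀ φs : ℝ) : EReal) ≤ dualValue A l₀ l :=
    le_trans (le_iInf₂ fun ψ hψ => EReal.coe_le_coe_iff.2 (hle ψ (hA hψ)))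
      (le_iSup₂ (f := fun lam (_ : lam ∈ {lam : EuclideanSpace ℝ (Fin m) | ∀ i, 0 ≤ lam i}) =>
        dualFunction A l₀ l lam) lam' hlam')
  have h2 : dualFunction A l₀ l lam ≤ ((lagrangian l₀ l φ lam : ℝ) : EReal) :=
    iInf₂_le φ hφ
  have h3 := (EReal.sub_le_sub h1 (le_refl (ε : EReal))).trans (hlam.trans h2)
  exact_mod_cast h3

omit [NormedSpace ℝ H] in
/-- The constraint vector is Lipschitz with the constant given by either of the two admissible
smoothness constants of the dual function. -/
theorem norm_constraintVec_sub_sq_le {F : Set H} {l : Fin m → H → ℝ} {K : ℝ≥0} {μ βg : ℝ}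
    (hμ : 0 < μ) (hm : 1 ≤ m) (hl : ∀ i, LipschitzOnWith K (l i) F)
    (hβg : βg = m * K ^ 2 / μ ∨ (LipschitzOnWith K (constraintVec l) F ∧ βg = √m * K ^ 2 / μ))
    {φ ψ : H} (hφ : φ ∈ F) (hψ : ψ ∈ F) :
    ‖constraintVec l φ - constraintVec l ψ‖ ^ 2 ≤ βg * μ * ‖φ - ψ‖ ^ 2 := by
  rcases hβg with rfl | ⟨hv, rfl⟩
  · rw [div_mul_cancel₀ _ hμ.ne', EuclideanSpace.norm_sq_eq]
    calc ∑ i, ‖(constraintVec l φ - constraintVec l ψ) i‖ ^ 2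
        ≤ ∑ _i : Fin m, (K * ‖φ - ψ‖) ^ 2 := by
          refine Finset.sum_le_sum fun i _ => pow_le_pow_left₀ (norm_nonneg _) ?_ 2
          have := (hl i).dist_le_mul φ hφ ψ hψ
          rwa [dist_eq_norm, dist_eq_norm] at this
      _ = m * K ^ 2 * ‖φ - ψ‖ ^ 2 := by
          rw [Finset.sum_const, Finset.card_univ, Fintype.card_fin, nsmul_eq_mul]; ring
  · rw [div_mul_cancel₀ _ hμ.ne']
    have h1 := hv.dist_le_mul φ hφ ψ hψ
    rw [dist_eq_norm, dist_eq_norm] at h1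
    -- The vector Lipschitz bound already gives `K²`; the factor `√m ≥ 1` is slack.
    have h2 : 1 ≤ √(m : ℝ) := Real.one_le_sqrt.2 (by exact_mod_cast hm)
    calc ‖constraintVec l φ - constraintVec l ψ‖ ^ 2 ≤ (K * ‖φ - ψ‖) ^ 2 := by gcongr
      _ = 1 * (K ^ 2 * ‖φ - ψ‖ ^ 2) := by ring
      _ ≤ √m * (K ^ 2 * ‖φ - ψ‖ ^ 2) := by gcongr
      _ = _ := by ring

/-- Full row rank of the Jacobian of `K`-Lipschitz constraints forces `σ ≤ K`. -/
theorem HasFullRowRankAt.le_of_lipschitzOnWith {F : Set H} (hF : Convex ℝ F) {σ : ℝ}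
    {l : Fin m → H → ℝ} {φ : H} (hφ : φ ∈ F) (hrank : HasFullRowRankAt F σ l φ) (hm : 1 ≤ m)
    {K : ℝ≥0} (hl : ∀ i, LipschitzOnWith K (l i) F) : σ ≤ K := by
  classical
  obtain ⟨B, hB, hσ⟩ := hrank
  -- On a coordinate vector, the rank condition bounds a single constraint derivative from below.
  have h1 := hσ (EuclideanSpace.single ⟨0, hm⟩ 1) (by simp)
  have h2 : ∑ i, (EuclideanSpace.single (⟨0, hm⟩ : Fin m) (1 : ℝ)) i • B i = B ⟨0, hm⟩ := by
    simp
  rw [h2] at h1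
  exact h1.trans (dualNormOn_le_of_lipschitzOnWith hF (hl _) hφ (hB _))

end Duality

/-! ### Comparison of the constants and the final bound -/

/-- The strong concavity constant of the dual function is at most its smoothness constant. -/
theorem one_le_div_dualConstants {m : ℕ} {M β μ₀ σ r βg : ℝ} (hμ₀ : 0 < μ₀) (hσ : 0 < σ)
    (hr : 0 ≤ r) (hσM : σ ≤ M) (hμβ : μ₀ ≤ β) (hm : 1 ≤ m)
    (hβg : βg = m * M ^ 2 / μ₀ ∨ βg = √m * M ^ 2 / μ₀) :
    1 ≤ βg / (μ₀ * σ ^ 2 / (β ^ 2 * (1 + r) ^ 2)) := by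
  have hβ : 0 < β := hμ₀.trans_le hμβ
  have h1 : M ^ 2 / μ₀ ≤ βg := by
    have hm' : (1 : ℝ) ≤ m := by exact_mod_cast hm
    rcases hβg with rfl | rfl
    · gcongr
      exact le_mul_of_one_le_left (sq_nonneg _) hm'
    · gcongr
      exact le_mul_of_one_le_left (sq_nonneg _) (Real.one_le_sqrt.2 hm')
  rw [one_le_div (by positivity)]
  refine le_trans ?_ h1
  rw [div_le_div_iff₀ (by positivity) hμ₀]
  have h2 : 1 ≤ (1 + r) ^ 2 := one_le_pow₀ (by linarith)
  calc μ₀ * σ ^ 2 * μ₀ = σ ^ 2 * (μ₀ ^ 2 * 1) := by ring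
    _ ≤ M ^ 2 * (β ^ 2 * (1 + r) ^ 2) := by gcongr

theorem proposition4p1
    -- the data space, the convex compact class `F ⊆ L²` and the parametrized class
    {X : Type*} [MeasurableSpace X] (P : Measure X) (k p m : ℕ)
    (F : Set (HypSpace P k)) (hFconv : Convex ℝ F) (hFcomp : IsCompact F)
    (Θ : Set (EuclideanSpace ℝ (Fin p))) (f : EuclideanSpace ℝ (Fin p) → HypSpace P k)
    (hfF : ∀ θ ∈ Θ, f θ ∈ F)
    -- the objective and constraint functionals; only their values on `F` matter
    (l₀ : HypSpace P k → ℝ) (l : Fin m → HypSpace P k → ℝ)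
    -- convexity, Lipschitz continuity, strong convexity
    (M : ℝ≥0) (μ₀ : ℝ) (hμ₀ : 0 < μ₀)
    (hconv : ∀ i, ConvexOn ℝ F (l i)) (hLip₀ : LipschitzOnWith M l₀ F)
    (hLip : ∀ i, LipschitzOnWith M (l i) F) (hstrong : StrongConvexOn F μ₀ l₀)
    -- near-universality of the parametrization
    (ν : ℝ) (hν : ∀ φ ∈ F, ∃ θ ∈ Θ, ‖φ - f θ‖ ≤ ν)
    -- smoothness
    (β : ℝ≥0) (hsmooth₀ : IsSmoothOn F β l₀) (hsmooth : ∀ i, IsSmoothOn F β (l i))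
    -- the unparametrized primal and dual solutions, and full row rank of the Jacobian
    (φstar : HypSpace P k) (hφstar : IsPrimalSolution F l₀ l φstar)
    (lamU : EuclideanSpace ℝ (Fin m)) (hlamU : IsDualSolution F l₀ l lamU)
    (σ : ℝ) (hσ : 0 < σ) (hrank : HasFullRowRankAt F σ l φstar)
    -- the best dual iterate and an associated Lagrangian minimizer
    (η S ρ : ℝ) (hη : 0 < η) (hρ : 0 ≤ ρ)
    (lamBest : EuclideanSpace ℝ (Fin m)) (hlamBest : ∀ i, 0 ≤ lamBest i)
    (hbest : dualValue (f '' Θ) l₀ l - ((η * S ^ 2 / 2 + ρ : ℝ) : EReal)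
      ≤ dualFunction (f '' Θ) l₀ l lamBest)
    (fBest : HypSpace P k) (hfBest : fBest ∈ lagrangianMinimizers (f '' Θ) l₀ l lamBest)
    -- strict feasibility adapted to `lamBest`
    (hslater : ∃ φ ∈ F, ∀ i, l i φ < 0 ∧ l i φ < l i fBest ∧
      ∀ φBest ∈ lagrangianMinimizers F l₀ l lamBest, l i φ < l i φBest)
    -- the smoothness constant of the unparametrized dual function
    (βg : ℝ)
    (hβg : βg = m * M ^ 2 / μ₀ ∨
      (LipschitzOnWith M (constraintVec l) F ∧ βg = √m * M ^ 2 / μ₀))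
    -- its strong concavity constant
    (μg : ℝ)
    (hμg : μg = μ₀ * σ ^ 2 / (β ^ 2 * (1 + max (oneNorm lamU) (oneNorm lamBest)) ^ 2)) :
    ‖constraintVec l φstar - constraintVec l fBest‖ ^ 2 ≤
      2 * βg * (M * ν * (1 + oneNorm lamBest) + η * S ^ 2 / 2 + ρ) * (1 + √(βg / μg)) ^ 2 := by
  obtain ⟨hφF, hφfeas, -⟩ := id hφstar
  have hAF : f '' Θ ⊆ F := Set.image_subset_iff.2 hfF
  have hfF' : fBest ∈ F := hAF hfBest.1
  have hν0 : 0 ≤ ν := by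
    obtain ⟨θ, -, h⟩ := hν _ hφF
    exact (norm_nonneg _).trans h
  have hN := oneNorm_nonneg lamBest
  have hΔ : 0 ≤ M * ν * (1 + oneNorm lamBest) + η * S ^ 2 / 2 + ρ := by positivity
  have hβg0 : 0 ≤ βg := by
    rcases hβg with rfl | ⟨-, rfl⟩ <;> positivity
  -- Here the left side vanishes. Otherwise there are a constraint and two distinct points, as
  -- needed for `σ ≤ M` and `μ₀ ≤ β`.
  by_cases htriv : m = 0 ∨ F.Subsingleton
  · have h0 : constraintVec l φstar - constraintVec l fBest = 0 := by
      rcases htriv with rfl | hsub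
      · exact Subsingleton.elim _ _
      · rw [hsub hφF hfF', sub_self]
    rw [h0, norm_zero, zero_pow two_ne_zero]
    positivity
  rw [not_or, Set.not_subsingleton_iff] at htriv
  obtain ⟨hm0, hF2⟩ := htriv
  have hm : 1 ≤ m := Nat.one_le_iff_ne_zero.2 hm0
  obtain ⟨φb, hφb, hmin⟩ := hFcomp.exists_isMinOn ⟨_, hφF⟩
    (continuousOn_lagrangian hLip₀ hLip lamBest)
  have hmin' : ∀ ψ ∈ F, lagrangian l₀ l φb lamBest ≤ lagrangian l₀ l ψ lamBest :=
    isMinOn_iff.1 hmin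
  have hconv₀ : ConvexOn ℝ F l₀ := hstrong.convexOn fun r => by dsimp; positivity
  have hweak := sub_le_lagrangian_of_dualValue_sub_le hconv₀ hconv hAF
    (hslater.imp fun φ h => ⟨h.1, fun i => (h.2 i).1⟩) hφstar hbest hfBest.1
  have hfb : lagrangian l₀ l fBest lamBest - lagrangian l₀ l φb lamBest ≤
      M * ν * (1 + oneNorm lamBest) := by
    obtain ⟨θ, hθ, hdist⟩ := hν φb hφb
    have h1 := hfBest.2 _ (Set.mem_image_of_mem f hθ)
    have h2 := lagrangian_sub_le hLip₀ hLip lamBest (hfF θ hθ) hφb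
    rw [norm_sub_rev] at h2
    have h3 : M * (1 + oneNorm lamBest) * ‖φb - f θ‖ ≤ M * (1 + oneNorm lamBest) * ν := by
      gcongr
    linarith
  have hstar := lagrangian_le_of_nonpos (l₀ := l₀) hlamBest hφfeas
  set Δ : ℝ := M * ν * (1 + oneNorm lamBest) + η * S ^ 2 / 2 + ρ with hΔdef
  -- The squared distance is at most `βg μ₀ ‖ψ - φb‖²`, and quadratic growth gives `μ₀ ‖ψ - φb‖² ≤ 2
  -- Δ`.
  have hbound : ∀ ψ ∈ F, lagrangian l₀ l ψ lamBest - lagrangian l₀ l φb lamBest ≤ Δ →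
      ‖constraintVec l ψ - constraintVec l φb‖ ≤ √(2 * βg * Δ) := by
    intro ψ hψ hle
    have h1 := (strongConvexOn_lagrangian hstrong hconv hlamBest).norm_sub_sq_le hφb hmin' hψ
    have h2 := norm_constraintVec_sub_sq_le hμ₀ hm hLip hβg hψ hφb
    refine Real.le_sqrt_of_sq_le (h2.trans ?_)
    have h3 := mul_le_mul_of_nonneg_left (h1.trans hle) hβg0
    linarith
  -- Chain: `L(φstar) ≤ l₀ φstar ≤ L(fBest) + η S² / 2 + ρ ≤ L(φb) + Δ`.
  have h1 := hbound φstar hφF (by linarith)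
  have h2 := hbound fBest hfF' (by linarith [show 0 ≤ η * S ^ 2 / 2 by positivity])
  have hratio : 1 ≤ √(βg / μg) := by
    rw [Real.one_le_sqrt, hμg]
    exact one_le_div_dualConstants hμ₀ hσ ((oneNorm_nonneg lamU).trans (le_max_left _ _))
      (hrank.le_of_lipschitzOnWith hFconv hφF hm hLip) (hstrong.le_of_isSmoothOn hsmooth₀ hF2) hm
      (hβg.imp_right And.right)
  have h3 : ‖constraintVec l φstar - constraintVec l fBest‖ ≤
      √(2 * βg * Δ) * (1 + √(βg / μg)) := by
    have h4 := norm_sub_le_norm_sub_add_norm_sub (constraintVec l φstar) (constraintVec l φb)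
      (constraintVec l fBest)
    rw [norm_sub_rev (constraintVec l φb)] at h4
    have h5 := mul_le_mul_of_nonneg_left hratio (Real.sqrt_nonneg (2 * βg * Δ))
    linarith
  calc ‖constraintVec l φstar - constraintVec l fBest‖ ^ 2
      ≤ (√(2 * βg * Δ) * (1 + √(βg / μg))) ^ 2 := by gcongr
    _ = 2 * βg * Δ * (1 + √(βg / μg)) ^ 2 := by
      rw [mul_pow, Real.sq_sqrt (by positivity)]
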